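/- Let $\mathbb D=\{p_{st}+p_{\mathcal I}\epsilon : p_{st},p_{\mathcal I}\in\mathbb R\}$ be the dual numbers and $\mathbb{DQ}=\{q_{st}+q_{\mathcal I}\epsilon : q_{st},q_{\mathcal I}\in\mathbb H\}$ the dual quaternions, where $\mathbb H$ denotes the real quaternions, $\epsilon^2=0$ and $\epsilon$ commutes with quaternions. Conjugation on $\mathbb{DQ}$ is $q^*=q_{st}^*+q_{\mathcal I}^*\epsilon$, and $A^*=(a_{ji}^*)$ is the conjugate transpose of a matrix $A=(a_{ij})$ over $\mathbb{DQ}$. A square matrix $A$ over $\mathbb{DQ}$ is unitary if $A^*A=I$. The dual numbers are totally ordered by: $p\le q$ if and only if $p_{st}<q_{st}$, or $p_{st}=q_{st}$ and $p_{\mathcal I}\le q_{\mathcal I}$. A dual number $p$ is positive if $p>0$, appreciable if $p_{st}\ne 0$, and infinitesimal if $p_{st}=0$. **Theorem 6.1.** Let $B\in\mathbb{DQ}^{m\times n}$. Then there exist unitary matrices $\hat V\in\mathbb{DQ}^{m\times m}$ and $\hat U\in\mathbb{DQ}^{n\times n}$ such that $$\hat V^*B\hat U=\begin{bmatrix}\Sigma_t&O\\O&O\end{bmatrix},\qquad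 \Sigma_t=\mathrm{diag}(\mu_1,\dots,\mu_r,\dots,\mu_t)\in\mathbb D^{t\times t},$$ where $0\le r\le t\le\min\{m,n\}$, $\mu_1\ge\mu_2\ge\cdots\ge\mu_r$ are positive appreciable dual numbers, and $\mu_{r+1}\ge\cdots\ge\mu_t$ are positive infinitesimal dual numbers. Moreover, $\Sigma_t$ is unique, counting multiplicities of its diagonal entries: for any two such decompositions of $B$, the numbers $r$ and $t$ and the sequences $(\mu_1,\dots,\mu_t)$ coincide. -/

import Mathlib

open scoped Quaternion Matrix

/-- The dual numbers `𝔻 = {p_st + p_I ε : p_st, p_I ∈ ℝ}`, `ε² = 0`.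
`p.fst` is the standard part and `p.snd` is the infinitesimal part. -/
abbrev DualReal : Type := DualNumber ℝ

/-- The dual quaternions `𝔻ℚ = {q_st + q_I ε : q_st, q_I ∈ ℍ}`, where `ε² = 0` and `ε` is central.
`q.fst` is the standard part and `q.snd` is the infinitesimal part. -/
abbrev DualQuat : Type := DualNumber ℍ[ℝ]

namespace DualReal

/-- The total order: `p ≤ q` iff `p_st < q_st`, or `p_st = q_st` and `p_I ≤ q_I`. -/
noncomputable instance instLinearOrder : LinearOrder DualReal where
  le p q := p.fst < q.fst ∨ (p.fst = q.fst ∧ p.snd ≤ q.snd)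
  le_refl p := Or.inr ⟨rfl, le_refl _⟩
  le_trans p q s h₁ h₂ := by
    rcases h₁ with h₁ | ⟨h₁, h₁'⟩ <;> rcases h₂ with h₂ | ⟨h₂, h₂'⟩
    · exact Or.inl (h₁.trans h₂)
    · exact Or.inl (h₂ ▸ h₁)
    · exact Or.inl (h₁ ▸ h₂)
    · exact Or.inr ⟨h₁.trans h₂, h₁'.trans h₂'⟩
  le_antisymm p q h₁ h₂ := by
    rcases h₁ with h₁ | ⟨h₁, h₁'⟩ <;> rcases h₂ with h₂ | ⟨h₂, h₂'⟩
    · exact absurd h₂ h₁.asymm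
    · exact absurd h₂.symm h₁.ne
    · exact absurd h₁.symm h₂.ne
    · exact TrivSqZeroExt.ext h₁ (le_antisymm h₁' h₂')
  le_total p q := by
    rcases lt_trichotomy p.fst q.fst with h | h | h
    · exact Or.inl (Or.inl h)
    · exact (le_total p.snd q.snd).imp (fun h' => Or.inr ⟨h, h'⟩) (fun h' => Or.inr ⟨h.symm, h'⟩)
    · exact Or.inr (Or.inl h)
  toDecidableLE := Classical.decRel _

/-- A dual number is appreciable if its standard part is nonzero. -/
def IsAppreciable (p : DualReal) : Prop := p.fst ≠ 0

/-- A dual number is infinitesimal if its standard part is zero. -/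
def IsInfinitesimal (p : DualReal) : Prop := p.fst = 0

/-- The inclusion `𝔻 ⊆ 𝔻ℚ`, sending `p_st + p_I ε` to `p_st + p_I ε`. -/
noncomputable def toDualQuat (p : DualReal) : DualQuat :=
  TrivSqZeroExt.inl (p.fst : ℍ[ℝ]) + TrivSqZeroExt.inr (p.snd : ℍ[ℝ])

end DualReal

namespace DualQuat

/-- The conjugate `q* = q_st* + q_I* ε`. -/
noncomputable instance instStarRing : StarRing DualQuat where
  star q := TrivSqZeroExt.inl (star q.fst) + TrivSqZeroExt.inr (star q.snd)
  star_involutive q := by ext <;> simp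
  star_mul p q := by
    apply TrivSqZeroExt.ext
    · simp
    · simp [add_comm]
  star_add p q := by
    apply TrivSqZeroExt.ext <;> simp

/-- A square dual quaternion matrix `A` is unitary if `A* A = I`. -/
def IsUnitary {n : ℕ} (A : Matrix (Fin n) (Fin n) DualQuat) : Prop := Aᴴ * A = 1

/-- The `m × n` matrix with upper left `t × t` block `diag(μ₁, …, μ_t)` and zeros elsewhere
(meant for `t ≤ min m n`). -/
noncomputable def blockDiag (m n : ℕ) {t : ℕ} (μ : Fin t → DualReal) : Matrix (Fin m) (Fin n) DualQuat :=
  Matrix.of fun i j =>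
    if h : i.val = j.val ∧ i.val < t then (μ ⟨i.val, h.2⟩).toDualQuat else 0

/-- `V* B U = [Σ_t O; O O]` is a singular value decomposition of the `m × n` matrix `B`, where
`Σ_t = diag(μ₁, …, μ_r, …, μ_t)`, `μ₁ ≥ … ≥ μ_r` are positive appreciable dual numbers
and `μ_{r+1} ≥ … ≥ μ_t` are positive infinitesimal dual numbers.
The indices below start at `0`. -/
structure IsSVD {m n : ℕ} (B : Matrix (Fin m) (Fin n) DualQuat)
    (V : Matrix (Fin m) (Fin m) DualQuat) (U : Matrix (Fin n) (Fin n) DualQuat)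
    (r t : ℕ) (μ : Fin t → DualReal) : Prop where
  unitary_left : IsUnitary V
  unitary_right : IsUnitary U
  r_le_t : r ≤ t
  t_le_min : t ≤ min m n
  eq_blockDiag : Vᴴ * B * U = blockDiag m n μ
  pos : ∀ i : Fin t, 0 < μ i
  appreciable : ∀ i : Fin t, i.val < r → (μ i).IsAppreciable
  infinitesimal : ∀ i : Fin t, r ≤ i.val → (μ i).IsInfinitesimal
  appreciable_antitone : ∀ i j : Fin t, i ≤ j → j.val < r → μ j ≤ μ i
  infinitesimal_antitone : ∀ i j : Fin t, r ≤ i.val → i ≤ j → μ j ≤ μ i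

end DualQuat

/-! Existence is by peeling off singular pairs. Suppose the standard part of `B` is nonzero. The
standard part of `Bᴴ * B` is then a nonzero positive semidefinite quaternion matrix, hence a
symmetric real operator with a positive eigenvalue `l₀`. First-order perturbation theory lifts this
to an exact dual eigenvalue, since `ε² = 0` leaves no higher-order terms. Its dual square root `μ`
is invertible and `μ⁻¹ B u` is the left vector (`isSingularPair_of_eigenvector`). If the standard
part of `B` vanishes, then `B = ε C` and a pair for `C` gives one for `B` with value `ε μ`.
Completing both vectors to unitary matrices splits off a `1 × 1` block, and induction and sorting
finish.

For uniqueness, put `Z = Uᴴ * U'` and `W = Vᴴ * V'`. The relation `Σ Z = W Σ'` and its counterpart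
for `Bᴴ` give `p z = q w` and `p w = q z` entrywise, which makes `z` infinitesimal when `p ≠ q`
(`fst_eq_zero_of_mul_eq_mul`). The standard part of `Z` is thus a unitary quaternion matrix
supported where the singular values agree, so multiplicities agree by double counting its squared
entries. -/

/-! ### Eigenvalues of real symmetric operators. -/

section RealSymmetric

variable {E : Type*} [NormedAddCommGroup E] [InnerProductSpace ℝ E] [FiniteDimensional ℝ E]

/-- First order perturbation of an eigenvalue: if `l₀` is an eigenvalue of the symmetric operator
`T₀`, then `T₀ + ε T₁` has an eigenvalue `l₀ + ε l₁` with a normalized eigenvector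
`u₀ + ε u₁`, up to terms of order `ε²`. -/
theorem LinearMap.IsSymmetric.exists_first_order_eigenpair {T₀ T₁ : E →ₗ[ℝ] E}
    (h₀ : T₀.IsSymmetric) (h₁ : T₁.IsSymmetric) {l₀ : ℝ} (hl : Module.End.HasEigenvalue T₀ l₀) :
    ∃ (u₀ u₁ : E) (l₁ : ℝ), inner ℝ u₀ u₀ = 1 ∧ inner ℝ u₀ u₁ = 0 ∧ T₀ u₀ = l₀ • u₀ ∧
      T₁ u₀ + T₀ u₁ = l₁ • u₀ + l₀ • u₁ := by
  set K := Module.End.eigenspace T₀ l₀ with hK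
  have : Nontrivial K := Submodule.nontrivial_iff_ne_bot.mpr hl
  -- As `l₀` may be degenerate, `u₀` must be an eigenvector of the compression of `T₁` to the
  -- eigenspace. This makes `T₁ u₀ - l₁ u₀` orthogonal to `ker (T₀ - l₀)`, so it lies in the range
  -- of `T₀ - l₀`.
  let S : K →ₗ[ℝ] K := K.orthogonalProjectionOnto.toLinearMap ∘ₗ T₁ ∘ₗ K.subtype
  have hinner : ∀ x y : K, inner ℝ (S x) y = inner ℝ (T₁ x) (y : E) := fun x y =>
    Submodule.inner_orthogonalProjectionOnto_eq_of_mem_right y (T₁ x)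
  have hS : S.IsSymmetric := fun x y => by
    rw [hinner, h₁, real_inner_comm, ← hinner, real_inner_comm]
  obtain ⟨w, hw⟩ := hS.hasEigenvalue_iSup_of_finiteDimensional.exists_hasEigenvector
  set l₁ : ℝ := ⨆ x : { x : K // x ≠ 0 }, RCLike.re (inner ℝ (S ↑x) (x : K)) / ‖(x : K)‖ ^ 2
  have hw₀ : ‖w‖ ≠ 0 := norm_ne_zero_iff.mpr hw.2
  set u : K := ‖w‖⁻¹ • w with hu
  have hSu : S u = l₁ • u := by
    rw [hu, map_smul, show S w = l₁ • w from hw.apply_eq_smul, smul_comm]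
  have hTu : T₀ u = l₀ • (u : E) := Module.End.mem_eigenspace_iff.mp u.2
  have huu : inner ℝ (u : E) (u : E) = 1 := by
    rw [real_inner_self_eq_norm_sq, Submodule.norm_coe, hu, norm_smul, norm_inv, norm_norm,
      inv_mul_cancel₀ hw₀, one_pow]
  have hT₀' : (T₀ - l₀ • LinearMap.id).IsSymmetric :=
    h₀.sub (LinearMap.IsSymmetric.smul (by simp) LinearMap.IsSymmetric.id)
  have hmem : T₁ u - l₁ • (u : E) ∈ (T₀ - l₀ • LinearMap.id).range := by
    have hrange := Submodule.orthogonal_orthogonal (LinearMap.range (T₀ - l₀ • LinearMap.id))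
    rw [← hrange, hT₀'.orthogonal_range, Submodule.mem_orthogonal']
    intro y hy
    have hyK : y ∈ K := by
      rw [hK, Module.End.mem_eigenspace_iff]
      simpa [sub_eq_zero] using hy
    have := hinner u ⟨y, hyK⟩
    rw [hSu] at this
    rw [inner_sub_left, ← this]
    simp [inner_smul_left]
  obtain ⟨z, hz⟩ := hmem
  have hz' : T₀ z - l₀ • z = T₁ u - l₁ • (u : E) := by simpa using hz
  -- The multiple of `u` makes the correction orthogonal to `u` and is killed by `T₀ - l₀`.
  refine ⟨u, inner ℝ (u : E) z • (u : E) - z, l₁, huu, ?_, hTu, ?_⟩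
  · rw [inner_sub_right, inner_smul_right, huu, mul_one, sub_self]
  · rw [map_sub, map_smul, hTu]
    rw [eq_sub_iff_add_eq] at hz'
    rw [← hz']
    module

theorem LinearMap.IsSymmetric.exists_hasEigenvalue_ne_zero {T : E →ₗ[ℝ] E}
    (hT : T.IsSymmetric) (h : T ≠ 0) : ∃ l : ℝ, l ≠ 0 ∧ Module.End.HasEigenvalue T l := by
  by_contra! hl
  refine h ((hT.eigenvectorBasis rfl).toBasis.ext fun i => ?_)
  have h0 : hT.eigenvalues rfl i = 0 := by
    by_contra hne
    exact hl _ hne (hT.hasEigenvalue_eigenvalues rfl i)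
  simp [h0]

end RealSymmetric

/-! ### Arithmetic of dual numbers and dual quaternions, and unitary matrices. -/

namespace DualQuat

@[simp] theorem fst_star (x : DualQuat) : (star x).fst = star x.fst := by
  change (TrivSqZeroExt.inl (star x.fst) + TrivSqZeroExt.inr (star x.snd) : DualQuat).fst = _
  simp

@[simp] theorem snd_star (x : DualQuat) : (star x).snd = star x.snd := by
  change (TrivSqZeroExt.inl (star x.fst) + TrivSqZeroExt.inr (star x.snd) : DualQuat).snd = _
  simp

end DualQuat

namespace DualReal

theorem le_iff {p q : DualReal} : p ≤ q ↔ p.fst < q.fst ∨ (p.fst = q.fst ∧ p.snd ≤ q.snd) :=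
  Iff.rfl

theorem lt_iff {p q : DualReal} : p < q ↔ p.fst < q.fst ∨ (p.fst = q.fst ∧ p.snd < q.snd) := by
  rw [← not_le, le_iff]
  constructor
  · intro h
    push Not at h
    rcases h.1.lt_or_eq with h' | h'
    · exact Or.inl h'
    · exact Or.inr ⟨h', h.2 h'.symm⟩
  · rintro (h | ⟨h, h'⟩) (h'' | ⟨h'', h'''⟩)
    all_goals linarith

@[simp] theorem fst_toDualQuat (p : DualReal) : p.toDualQuat.fst = (p.fst : ℍ[ℝ]) := by
  simp [toDualQuat]

@[simp] theorem snd_toDualQuat (p : DualReal) : p.toDualQuat.snd = (p.snd : ℍ[ℝ]) := by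
  simp [toDualQuat]

theorem toDualQuat_commute (p : DualReal) (x : DualQuat) : p.toDualQuat * x = x * p.toDualQuat := by
  apply TrivSqZeroExt.ext
  · simpa using Quaternion.coe_commutes _ _
  · simp [Quaternion.coe_commutes, add_comm]

@[simp] theorem toDualQuat_zero : toDualQuat 0 = 0 := by
  apply TrivSqZeroExt.ext <;> simp

@[simp] theorem toDualQuat_one : toDualQuat 1 = 1 := by
  apply TrivSqZeroExt.ext <;> simp

theorem toDualQuat_mul (p q : DualReal) : (p * q).toDualQuat = p.toDualQuat * q.toDualQuat := by
  apply TrivSqZeroExt.ext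
  · simp
  · simp

theorem toDualQuat_add (p q : DualReal) : (p + q).toDualQuat = p.toDualQuat + q.toDualQuat := by
  apply TrivSqZeroExt.ext <;> simp

theorem toDualQuat_sub (p q : DualReal) : (p - q).toDualQuat = p.toDualQuat - q.toDualQuat := by
  apply TrivSqZeroExt.ext <;> simp

@[simp] theorem star_toDualQuat (p : DualReal) : star p.toDualQuat = p.toDualQuat := by
  apply TrivSqZeroExt.ext <;> simp

/-- A nonzero dual number annihilates only infinitesimal dual quaternions. -/
theorem fst_eq_zero_of_toDualQuat_mul_eq_zero {p : DualReal} (hp : p ≠ 0) {x : DualQuat}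
    (h : p.toDualQuat * x = 0) : x.fst = 0 := by
  have h₁ := congrArg TrivSqZeroExt.fst h
  have h₂ := congrArg TrivSqZeroExt.snd h
  simp only [TrivSqZeroExt.fst_mul, TrivSqZeroExt.snd_mul, fst_toDualQuat, snd_toDualQuat,
    TrivSqZeroExt.fst_zero, TrivSqZeroExt.snd_zero, smul_eq_mul, op_smul_eq_mul,
    mul_eq_zero] at h₁ h₂
  rcases h₁ with h₁ | h₁
  · rw [h₁, zero_mul, zero_add, mul_eq_zero] at h₂
    refine h₂.resolve_left fun h₃ => hp (TrivSqZeroExt.ext ?_ ?_)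
    · simpa [← Quaternion.coe_zero, Quaternion.coe_inj] using h₁
    · simpa [← Quaternion.coe_zero, Quaternion.coe_inj] using h₃
  · exact h₁

end DualReal

namespace DualQuat

theorem IsUnitary.mul {n : ℕ} {A B : Matrix (Fin n) (Fin n) DualQuat}
    (hA : IsUnitary A) (hB : IsUnitary B) : IsUnitary (A * B) := by
  rw [IsUnitary, Matrix.conjTranspose_mul, Matrix.mul_assoc, ← Matrix.mul_assoc Aᴴ, hA,
    Matrix.one_mul, hB]

theorem IsUnitary.mul_conjTranspose {n : ℕ} {A : Matrix (Fin n) (Fin n) DualQuat}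
    (hA : IsUnitary A) : A * Aᴴ = 1 :=
  mul_eq_one_comm.mp hA

theorem IsUnitary.conjTranspose {n : ℕ} {A : Matrix (Fin n) (Fin n) DualQuat}
    (hA : IsUnitary A) : IsUnitary Aᴴ := by
  rw [IsUnitary, Matrix.conjTranspose_conjTranspose, hA.mul_conjTranspose]

end DualQuat

/-! ### Completing a unit vector to a unitary matrix. -/

/-- A unit column `(a, b)` over a star ring such that `1 + a*` is right invertible is the first
column of a matrix with orthonormal columns. -/
theorem Matrix.exists_conjTranspose_mul_self_eq_one_cons {R : Type*} [Ring R] [StarRing R] {n : ℕ}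
    (a k : R) (b : Fin n → R) (hk : (1 + star a) * k = 1)
    (hab : ∑ i, star (b i) * b i = 1 - star a * a) :
    ∃ U : Matrix (Fin (n + 1)) (Fin (n + 1)) R, Uᴴ * U = 1 ∧ U 0 0 = a ∧
      ∀ i : Fin n, U i.succ 0 = b i := by
  have hk' : star k * (1 + a) = 1 := by simpa using congrArg star hk
  -- Over the reals this is the rotation taking `e₀` to `(a, b)` and fixing the vectors orthogonal
  -- to both; the factor `(1 + a) * k` is what noncommutativity adds.
  let U : Matrix (Fin (n + 1)) (Fin (n + 1)) R := Matrix.of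
    (Fin.cons (Fin.cons a fun j => -((1 + a) * k * star (b j)))
      (fun i => Fin.cons (b i) fun j => (1 : Matrix (Fin n) (Fin n) R) i j - b i * k * star (b j)))
  have U00 : U 0 0 = a := rfl
  have U0s : ∀ j : Fin n, U 0 j.succ = -((1 + a) * k * star (b j)) := fun _ => rfl
  have Us0 : ∀ i : Fin n, U i.succ 0 = b i := fun _ => rfl
  have Uss : ∀ i j : Fin n, U i.succ j.succ =
      (1 : Matrix (Fin n) (Fin n) R) i j - b i * k * star (b j) := fun _ _ => rfl
  have h0s : ∀ j : Fin n, (Uᴴ * U) 0 j.succ = 0 := by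
    intro j
    have hsum : ∑ i, star (b i) * (b i * k * star (b j)) =
        (1 - star a * a) * (k * star (b j)) := by
      rw [← hab, Finset.sum_mul]
      simp only [mul_assoc]
    simp only [Matrix.mul_apply, Matrix.conjTranspose_apply, Fin.sum_univ_succ, U00, U0s, Us0, Uss,
      mul_sub, Finset.sum_sub_distrib, hsum]
    simp only [Matrix.one_apply, mul_ite, mul_one, mul_zero, Finset.sum_ite_eq', Finset.mem_univ,
      if_true]
    calc _ = (1 - (1 + star a) * k) * star (b j) := by noncomm_ring
      _ = 0 := by rw [hk, sub_self, zero_mul]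
  refine ⟨U, ?_, U00, Us0⟩
  ext i j
  induction i using Fin.cases with
  | zero =>
    induction j using Fin.cases with
    | zero => simp [Matrix.mul_apply, Fin.sum_univ_succ, U00, Us0, hab]
    | succ j => rw [h0s, Matrix.one_apply_ne (Fin.succ_ne_zero j).symm]
  | succ i =>
    induction j using Fin.cases with
    | zero =>
      have hherm : (Uᴴ * U)ᴴ = Uᴴ * U := by simp
      rw [← hherm, Matrix.conjTranspose_apply, h0s, star_zero,
        Matrix.one_apply_ne (Fin.succ_ne_zero i)]
    | succ j =>
      have hsum : ∑ l, star (b l * k * star (b i)) * (b l * k * star (b j)) =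
          b i * star k * (1 - star a * a) * (k * star (b j)) := by
        rw [← hab, Finset.mul_sum, Finset.sum_mul]
        simp only [mul_assoc, star_mul, star_star]
      have hone : (1 : Matrix (Fin (n + 1)) (Fin (n + 1)) R) i.succ j.succ =
          (1 : Matrix (Fin n) (Fin n) R) i j := by
        simp [Matrix.one_apply]
      have hδ : ∀ l, star ((1 : Matrix (Fin n) (Fin n) R) l i) = if l = i then 1 else 0 := by
        intro l
        rw [Matrix.one_apply]
        split_ifs <;> simp
      simp only [Matrix.mul_apply, Matrix.conjTranspose_apply, Fin.sum_univ_succ, U0s, Uss,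
        mul_sub, sub_mul, star_sub, Finset.sum_sub_distrib, hsum, hone, hδ]
      simp only [Matrix.one_apply, mul_ite, ite_mul, mul_one, one_mul, zero_mul, mul_zero,
        Finset.sum_ite_eq', Finset.mem_univ, if_true, star_neg, star_mul, star_star]
      -- This is the coefficient between `b i` and `star (b j)` in the lower right block.
      have key : star k * (star (1 + a) * (1 + a)) * k - star k - k +
          star k * (1 - star a * a) * k = 0 := by
        have : star k * (star (1 + a) * (1 + a)) * k - star k - k +
            star k * (1 - star a * a) * k =
            (star k * (1 + a) - 1) * k + star k * ((1 + star a) * k - 1) := by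
          rw [star_add, star_one]
          noncomm_ring
        rw [this, hk, hk']
        simp
      calc _ = (if j = i then 1 else 0) + b i * (star k * (star (1 + a) * (1 + a)) * k - star k - k +
              star k * (1 - star a * a) * k) * star (b j) := by noncomm_ring
        _ = _ := by rw [key]; simp [eq_comm]

namespace DualQuat

/-- Every unit vector is the first column of a unitary matrix. -/
theorem exists_isUnitary_col_zero {n : ℕ} (u : Fin (n + 1) → DualQuat) (hu : star u ⬝ᵥ u = 1) :
    ∃ U, IsUnitary U ∧ ∀ i, U i 0 = u i := by
  -- The completion needs `1 + star (u 0)` invertible, which fails only for standard part `-1`;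
  -- passing to `-u` changes that to `1`.
  wlog h : (u 0).fst ≠ -1 generalizing u
  · obtain ⟨U, hU, hUu⟩ := this (-u) (by simpa using hu) (by
      push Not at h
      simp only [Pi.neg_apply, TrivSqZeroExt.fst_neg, h, neg_neg]
      intro h'
      have := congrArg QuaternionAlgebra.re h'
      norm_num at this)
    exact ⟨-U, by simpa [IsUnitary] using hU, fun i => by simp [hUu]⟩
  have hunit : IsUnit (1 + star (u 0)) := by
    rw [TrivSqZeroExt.isUnit_iff_isUnit_fst, isUnit_iff_ne_zero]
    intro h'
    rw [TrivSqZeroExt.fst_add, fst_star, TrivSqZeroExt.fst_one] at h'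
    apply h
    rw [← star_star (TrivSqZeroExt.fst (u 0)), eq_neg_of_add_eq_zero_right h']
    simp
  obtain ⟨k, hk⟩ := hunit.exists_right_inv
  obtain ⟨U, hU, h0, hs⟩ := Matrix.exists_conjTranspose_mul_self_eq_one_cons (u 0) k
    (fun i => u i.succ) hk (by
      rw [dotProduct, Fin.sum_univ_succ] at hu
      rw [← hu]
      simp)
  exact ⟨U, hU, fun i => Fin.cases h0 hs i⟩

/-! ### Singular pairs from eigenvectors. -/

theorem mulVec_toDualQuat_smul {m n : ℕ} (B : Matrix (Fin m) (Fin n) DualQuat) (p : DualReal)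
    (u : Fin n → DualQuat) : B *ᵥ (p.toDualQuat • u) = p.toDualQuat • (B *ᵥ u) := by
  ext1 i
  simp only [Matrix.mulVec, dotProduct, Pi.smul_apply, smul_eq_mul, Finset.mul_sum]
  refine Finset.sum_congr rfl fun j _ => ?_
  rw [← mul_assoc, ← p.toDualQuat_commute, mul_assoc]

theorem dotProduct_toDualQuat_smul {n : ℕ} (p : DualReal) (u v : Fin n → DualQuat) :
    v ⬝ᵥ (p.toDualQuat • u) = p.toDualQuat * (v ⬝ᵥ u) := by
  simp only [dotProduct, Pi.smul_apply, smul_eq_mul, Finset.mul_sum]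
  refine Finset.sum_congr rfl fun j _ => ?_
  rw [← mul_assoc, ← p.toDualQuat_commute, mul_assoc]

/-- `u` and `v` are unit right and left singular vectors of `B` for the singular value `μ`. -/
structure IsSingularPair {m n : ℕ} (B : Matrix (Fin m) (Fin n) DualQuat) (u : Fin n → DualQuat)
    (v : Fin m → DualQuat) (μ : DualReal) : Prop where
  unit_right : star u ⬝ᵥ u = 1
  unit_left : star v ⬝ᵥ v = 1
  mulVec_right : B *ᵥ u = μ.toDualQuat • v
  mulVec_left : Bᴴ *ᵥ v = μ.toDualQuat • u

theorem isSingularPair_of_eigenvector {m n : ℕ} {B : Matrix (Fin m) (Fin n) DualQuat}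
    {u : Fin n → DualQuat} {μ ν : DualReal} (hu : star u ⬝ᵥ u = 1) (hν : ν * μ = 1)
    (h : (Bᴴ * B) *ᵥ u = (μ * μ).toDualQuat • u) :
    IsSingularPair B u (ν.toDualQuat • (B *ᵥ u)) μ where
  unit_right := hu
  unit_left := by
    have hstar : star (ν.toDualQuat • (B *ᵥ u)) = ν.toDualQuat • star (B *ᵥ u) := by
      ext1 i
      simp [DualReal.toDualQuat_commute]
    rw [dotProduct_toDualQuat_smul, hstar, smul_dotProduct, Matrix.star_mulVec,
      ← Matrix.dotProduct_mulVec, Matrix.mulVec_mulVec, h, dotProduct_toDualQuat_smul, hu, mul_one,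
      smul_eq_mul, ← DualReal.toDualQuat_mul, ← DualReal.toDualQuat_mul,
      show ν * (ν * (μ * μ)) = (ν * μ) * (ν * μ) by ring, hν]
    simp
  mulVec_right := by
    rw [smul_smul, ← DualReal.toDualQuat_mul, mul_comm, hν, DualReal.toDualQuat_one, one_smul]
  mulVec_left := by
    rw [mulVec_toDualQuat_smul, Matrix.mulVec_mulVec, h, smul_smul, ← DualReal.toDualQuat_mul,
      ← mul_assoc, hν, one_mul]

end DualQuat

/-! ### Quaternion matrices as real operators, and existence of a singular pair. -/

/-- A quaternion matrix as a real linear operator on column vectors. -/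
noncomputable def Matrix.quaternionToLin {m n : ℕ} (A : Matrix (Fin m) (Fin n) ℍ[ℝ]) :
    PiLp 2 (fun _ : Fin n => ℍ[ℝ]) →ₗ[ℝ] PiLp 2 (fun _ : Fin m => ℍ[ℝ]) where
  toFun x := WithLp.toLp 2 (A *ᵥ x.ofLp)
  map_add' x y := by simp [Matrix.mulVec_add]
  map_smul' c x := by simp [Matrix.mulVec_smul]

namespace Quaternion

theorem piLp_inner_eq {n : ℕ} (x y : PiLp 2 (fun _ : Fin n => ℍ[ℝ])) :
    inner ℝ x y = (star x.ofLp ⬝ᵥ y.ofLp).re := by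
  have hre : ∀ f : Fin n → ℍ[ℝ], (∑ i, f i).re = ∑ i, (f i).re := fun f =>
    map_sum (QuaternionAlgebra.reₗ (-1 : ℝ) 0 (-1)) f _
  rw [PiLp.inner_apply, dotProduct, hre]
  refine Finset.sum_congr rfl fun i _ => ?_
  rw [Quaternion.inner_def]
  simp

theorem coe_finset_sum {ι : Type*} (s : Finset ι) (f : ι → ℝ) :
    ((∑ i ∈ s, f i : ℝ) : ℍ[ℝ]) = ∑ i ∈ s, (f i : ℍ[ℝ]) :=
  map_sum (algebraMap ℝ ℍ[ℝ]) f s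

theorem inner_quaternionToLin_left {m n : ℕ} (A : Matrix (Fin m) (Fin n) ℍ[ℝ])
    (x : PiLp 2 (fun _ : Fin n => ℍ[ℝ])) (y : PiLp 2 (fun _ : Fin m => ℍ[ℝ])) :
    inner ℝ (A.quaternionToLin x) y = inner ℝ x (Aᴴ.quaternionToLin y) := by
  rw [piLp_inner_eq, piLp_inner_eq]
  simp [Matrix.quaternionToLin, Matrix.star_mulVec, Matrix.dotProduct_mulVec]

theorem isSymmetric_quaternionToLin {n : ℕ} {A : Matrix (Fin n) (Fin n) ℍ[ℝ]} (hA : Aᴴ = A) :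
    A.quaternionToLin.IsSymmetric := fun x y => by
  rw [inner_quaternionToLin_left, hA]

theorem quaternionToLin_mul_apply {l m n : ℕ} (A : Matrix (Fin l) (Fin m) ℍ[ℝ])
    (B : Matrix (Fin m) (Fin n) ℍ[ℝ]) (x : PiLp 2 (fun _ : Fin n => ℍ[ℝ])) :
    (A * B).quaternionToLin x = A.quaternionToLin (B.quaternionToLin x) := by
  simp [Matrix.quaternionToLin]

theorem quaternionToLin_injective {m n : ℕ} : Function.Injective
    (Matrix.quaternionToLin : Matrix (Fin m) (Fin n) ℍ[ℝ] → _) := by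
  intro A B h
  ext1 i j
  have := congrArg (fun x : PiLp 2 (fun _ : Fin m => ℍ[ℝ]) => x i)
    (LinearMap.congr_fun h (WithLp.toLp 2 (Pi.single j 1)))
  simpa [Matrix.quaternionToLin] using this

end Quaternion

namespace DualQuat

open Quaternion

/-- The dual vector with given standard and infinitesimal parts. -/
noncomputable def ofParts {n : ℕ} (x y : PiLp 2 (fun _ : Fin n => ℍ[ℝ])) : Fin n → DualQuat :=
  fun i => (x i, y i)

@[simp] theorem fst_ofParts {n : ℕ} (x y : PiLp 2 (fun _ : Fin n => ℍ[ℝ])) (i : Fin n) :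
    (ofParts x y i).fst = x i := rfl

@[simp] theorem snd_ofParts {n : ℕ} (x y : PiLp 2 (fun _ : Fin n => ℍ[ℝ])) (i : Fin n) :
    (ofParts x y i).snd = y i := rfl

/-- Real orthogonality suffices: the infinitesimal part is `x* y + y* x`, twice the real part of `x*
y`. -/
theorem star_dotProduct_ofParts {n : ℕ} {x y : PiLp 2 (fun _ : Fin n => ℍ[ℝ])}
    (hx : inner ℝ x x = (1 : ℝ)) (hxy : inner ℝ x y = (0 : ℝ)) :
    star (ofParts x y) ⬝ᵥ ofParts x y = 1 := by
  rw [PiLp.inner_apply] at hx hxy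
  apply TrivSqZeroExt.ext
  · rw [dotProduct, TrivSqZeroExt.fst_sum, TrivSqZeroExt.fst_one, ← Quaternion.coe_one, ← hx,
      coe_finset_sum]
    refine Finset.sum_congr rfl fun i _ => ?_
    rw [Quaternion.inner_self]
    simp [Quaternion.star_mul_self]
  · rw [dotProduct, TrivSqZeroExt.snd_sum, TrivSqZeroExt.snd_one, ← Quaternion.coe_zero,
      ← mul_zero (2 : ℝ), ← hxy, Finset.mul_sum, coe_finset_sum]
    refine Finset.sum_congr rfl fun i _ => ?_
    rw [Quaternion.inner_def]
    ext <;> simp <;> ring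

theorem map_fst_conjTranspose {m n : ℕ} (A : Matrix (Fin m) (Fin n) DualQuat) :
    Aᴴ.map TrivSqZeroExt.fst = (A.map TrivSqZeroExt.fst)ᴴ := by
  ext1 i j
  simp

theorem map_snd_conjTranspose {m n : ℕ} (A : Matrix (Fin m) (Fin n) DualQuat) :
    Aᴴ.map TrivSqZeroExt.snd = (A.map TrivSqZeroExt.snd)ᴴ := by
  ext1 i j
  simp

theorem map_fst_mul {l m n : ℕ} (A : Matrix (Fin l) (Fin m) DualQuat)
    (B : Matrix (Fin m) (Fin n) DualQuat) :
    (A * B).map TrivSqZeroExt.fst = A.map TrivSqZeroExt.fst * B.map TrivSqZeroExt.fst := by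
  ext1 i j
  simp [Matrix.mul_apply, TrivSqZeroExt.fst_sum]

theorem mulVec_ofParts {m n : ℕ} (A : Matrix (Fin m) (Fin n) DualQuat)
    (x y : PiLp 2 (fun _ : Fin n => ℍ[ℝ])) :
    A *ᵥ ofParts x y = ofParts ((A.map TrivSqZeroExt.fst).quaternionToLin x)
      ((A.map TrivSqZeroExt.snd).quaternionToLin x +
        (A.map TrivSqZeroExt.fst).quaternionToLin y) := by
  ext1 i
  apply TrivSqZeroExt.ext
  · simp [Matrix.quaternionToLin, Matrix.mulVec, dotProduct, TrivSqZeroExt.fst_sum]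
  · simp [Matrix.quaternionToLin, Matrix.mulVec, dotProduct, TrivSqZeroExt.snd_sum,
      Finset.sum_add_distrib, add_comm]

theorem toDualQuat_smul_ofParts {n : ℕ} (p : DualReal) (x y : PiLp 2 (fun _ : Fin n => ℍ[ℝ])) :
    p.toDualQuat • ofParts x y = ofParts (p.fst • x) (p.snd • x + p.fst • y) := by
  ext1 i
  apply TrivSqZeroExt.ext
  · simp [Quaternion.coe_mul_eq_smul]
  · simp [Quaternion.coe_mul_eq_smul, add_comm]

theorem exists_isSingularPair_of_map_fst_ne_zero {m n : ℕ} {B : Matrix (Fin m) (Fin n) DualQuat}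
    (hB : B.map TrivSqZeroExt.fst ≠ 0) : ∃ u v μ, 0 < TrivSqZeroExt.fst μ ∧
      IsSingularPair B u v μ := by
  set A := Bᴴ * B with hA
  have hherm : Aᴴ = A := by simp [hA]
  have h₀ := isSymmetric_quaternionToLin
    (A := A.map TrivSqZeroExt.fst) (by rw [← map_fst_conjTranspose, hherm])
  have h₁ := isSymmetric_quaternionToLin
    (A := A.map TrivSqZeroExt.snd) (by rw [← map_snd_conjTranspose, hherm])
  have hinner : ∀ x, inner ℝ ((A.map TrivSqZeroExt.fst).quaternionToLin x) x =
      inner ℝ ((B.map TrivSqZeroExt.fst).quaternionToLin x)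
        ((B.map TrivSqZeroExt.fst).quaternionToLin x) := by
    intro x
    rw [real_inner_comm, inner_quaternionToLin_left, ← quaternionToLin_mul_apply,
      ← map_fst_conjTranspose, ← map_fst_mul]
  have hA₀ : (A.map TrivSqZeroExt.fst).quaternionToLin ≠ 0 := by
    intro h
    apply hB
    apply quaternionToLin_injective
    ext1 x
    have := hinner x
    rw [h, LinearMap.zero_apply, inner_zero_left, eq_comm, inner_self_eq_zero] at this
    rw [this]
    simp [Matrix.quaternionToLin]
  obtain ⟨l₀, hl₀, hev⟩ := h₀.exists_hasEigenvalue_ne_zero hA₀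
  obtain ⟨x, y, l₁, hx, hxy, hAx, hAy⟩ := h₀.exists_first_order_eigenpair h₁ hev
  have hpos : 0 < l₀ := by
    refine lt_of_le_of_ne ?_ hl₀.symm
    have := hinner x
    rw [hAx, real_inner_smul_left, hx, mul_one] at this
    rw [this]
    exact real_inner_self_nonneg
  set s := Real.sqrt l₀ with hs
  have hs₀ : 0 < s := Real.sqrt_pos.mpr hpos
  have hss : s * s = l₀ := Real.mul_self_sqrt hpos.le
  -- The square root of `l₀ + l₁ ε` in the dual numbers.
  let μ : DualReal := (s, l₁ / (2 * s))
  have hμ₁ : μ.fst = s := rfl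
  have hμ₂ : μ.snd = l₁ / (2 * s) := rfl
  have hμμ₂ : s * (l₁ / (2 * s)) + l₁ / (2 * s) * s = l₁ := by
    field_simp
    ring
  have hμ : IsUnit μ := by
    rw [TrivSqZeroExt.isUnit_iff_isUnit_fst, hμ₁]
    exact hs₀.ne'.isUnit
  obtain ⟨ν, hν⟩ := hμ.exists_left_inv
  refine ⟨ofParts x y, _, μ, hs₀,
    isSingularPair_of_eigenvector (star_dotProduct_ofParts hx hxy) hν ?_⟩
  rw [← hA, mulVec_ofParts, toDualQuat_smul_ofParts, hAx, hAy]
  simp [hμ₁, hμ₂, hss, hμμ₂]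

theorem exists_isSingularPair {m n : ℕ} {B : Matrix (Fin m) (Fin n) DualQuat} (hB : B ≠ 0) :
    ∃ u v μ, 0 < μ ∧ IsSingularPair B u v μ := by
  by_cases h : B.map TrivSqZeroExt.fst = 0
  · let ε : DualReal := TrivSqZeroExt.inr 1
    let C : Matrix (Fin m) (Fin n) DualQuat :=
      Matrix.of fun i j => TrivSqZeroExt.inl (B i j).snd
    have hfst : ∀ i j, (B i j).fst = 0 := fun i j => congrFun (congrFun h i) j
    have hBC : ∀ i j, B i j = ε.toDualQuat * C i j := by
      intro i j
      apply TrivSqZeroExt.ext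
      · simp [ε, hfst]
      · simp [ε, C]
    have hC : C.map TrivSqZeroExt.fst ≠ 0 := by
      intro hC
      apply hB
      ext1 i j
      apply TrivSqZeroExt.ext
      · exact hfst i j
      · simpa [C] using congrFun (congrFun hC i) j
    have hBC' : B = ε.toDualQuat • C := by
      ext1 i j
      exact hBC i j
    have hBCs : Bᴴ = ε.toDualQuat • Cᴴ := by
      ext1 i j
      simp [hBC, DualReal.toDualQuat_commute]
    obtain ⟨u, v, μ, hμ, huv⟩ := exists_isSingularPair_of_map_fst_ne_zero hC
    refine ⟨u, v, ε * μ, ?_, huv.unit_right, huv.unit_left, ?_, ?_⟩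
    · rw [DualReal.lt_iff]
      right
      simpa [ε] using hμ
    · rw [hBC', Matrix.smul_mulVec, huv.mulVec_right, smul_smul, DualReal.toDualQuat_mul]
    · rw [hBCs, Matrix.smul_mulVec, huv.mulVec_left, smul_smul, DualReal.toDualQuat_mul]
  · obtain ⟨u, v, μ, hμ, huv⟩ := exists_isSingularPair_of_map_fst_ne_zero h
    exact ⟨u, v, μ, DualReal.lt_iff.mpr (Or.inl hμ), huv⟩

end DualQuat

/-! ### Bordered matrices, induction and sorting. -/

/-- The block diagonal matrix `diag(a, X)`. -/
def Matrix.borderDiag {R : Type*} [Zero R] {m n : ℕ} (a : R) (X : Matrix (Fin m) (Fin n) R) :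
    Matrix (Fin (m + 1)) (Fin (n + 1)) R :=
  Matrix.of (Fin.cons (Fin.cons a 0) fun i => Fin.cons 0 (X i))

namespace Matrix

section borderDiag

variable {R : Type*} {l m n : ℕ}

@[simp] theorem borderDiag_zero_zero [Zero R] (a : R) (X : Matrix (Fin m) (Fin n) R) :
    borderDiag a X 0 0 = a := rfl

@[simp] theorem borderDiag_zero_succ [Zero R] (a : R) (X : Matrix (Fin m) (Fin n) R) (j : Fin n) :
    borderDiag a X 0 j.succ = 0 := rfl

@[simp] theorem borderDiag_succ_zero [Zero R] (a : R) (X : Matrix (Fin m) (Fin n) R) (i : Fin m) :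
    borderDiag a X i.succ 0 = 0 := rfl

@[simp] theorem borderDiag_succ_succ [Zero R] (a : R) (X : Matrix (Fin m) (Fin n) R) (i : Fin m)
    (j : Fin n) : borderDiag a X i.succ j.succ = X i j := rfl

theorem ext_fin_succ {A B : Matrix (Fin (m + 1)) (Fin (n + 1)) R} (h00 : A 0 0 = B 0 0)
    (h0s : ∀ j : Fin n, A 0 j.succ = B 0 j.succ) (hs0 : ∀ i : Fin m, A i.succ 0 = B i.succ 0)
    (hss : ∀ (i : Fin m) (j : Fin n), A i.succ j.succ = B i.succ j.succ) : A = B := by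
  ext i j
  exact Fin.cases (Fin.cases h00 h0s j) (fun i => Fin.cases (hs0 i) (hss i) j) i

theorem borderDiag_mul [NonUnitalNonAssocSemiring R] (a b : R) (X : Matrix (Fin l) (Fin m) R)
    (Y : Matrix (Fin m) (Fin n) R) :
    borderDiag a X * borderDiag b Y = borderDiag (a * b) (X * Y) := by
  apply ext_fin_succ <;> intros <;> simp [Matrix.mul_apply, Fin.sum_univ_succ]

theorem borderDiag_conjTranspose [NonUnitalNonAssocSemiring R] [StarRing R] (a : R)
    (X : Matrix (Fin m) (Fin n) R) : (borderDiag a X)ᴴ = borderDiag (star a) Xᴴ := by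
  apply ext_fin_succ <;> intros <;> simp

theorem borderDiag_one [Zero R] [One R] :
    borderDiag 1 (1 : Matrix (Fin n) (Fin n) R) = 1 := by
  apply ext_fin_succ <;> intros <;> simp [Matrix.one_apply, (Fin.succ_ne_zero _).symm]

end borderDiag

end Matrix

namespace DualQuat

theorem isUnitary_one {n : ℕ} : IsUnitary (1 : Matrix (Fin n) (Fin n) DualQuat) := by
  simp [IsUnitary]

theorem IsUnitary.borderDiag {n : ℕ} {A : Matrix (Fin n) (Fin n) DualQuat} (hA : IsUnitary A) :
    IsUnitary (Matrix.borderDiag 1 A) := by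
  rw [IsUnitary, Matrix.borderDiag_conjTranspose, Matrix.borderDiag_mul, hA, star_one, one_mul,
    Matrix.borderDiag_one]

theorem IsUnitary.submatrix {n : ℕ} {A : Matrix (Fin n) (Fin n) DualQuat} (hA : IsUnitary A)
    (σ : Equiv.Perm (Fin n)) : IsUnitary (A.submatrix id σ) := by
  rw [IsUnitary, Matrix.conjTranspose_submatrix,
    ← Matrix.submatrix_mul _ _ _ _ _ Function.bijective_id, hA, Matrix.submatrix_one_equiv]

theorem blockDiag_of_le_left {m n t : ℕ} (μ : Fin t → DualReal) {i : Fin m} (j : Fin n)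
    (h : t ≤ i) : blockDiag m n μ i j = 0 :=
  dif_neg fun (h' : i.val = j.val ∧ i.val < t) => h.not_gt h'.2

theorem blockDiag_of_le_right {m n t : ℕ} (μ : Fin t → DualReal) (i : Fin m) {j : Fin n}
    (h : t ≤ j) : blockDiag m n μ i j = 0 :=
  dif_neg fun (h' : i.val = j.val ∧ i.val < t) => h.not_gt (h'.1 ▸ h'.2)

theorem blockDiag_castLE {m n t : ℕ} (μ : Fin t → DualReal) (hm : t ≤ m) (hn : t ≤ n)
    (a b : Fin t) : blockDiag m n μ (Fin.castLE hm a) (Fin.castLE hn b) =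
      if a = b then (μ a).toDualQuat else 0 := by
  simp [blockDiag, Fin.ext_iff]

theorem blockDiag_cons {m n t : ℕ} (p : DualReal) (μ : Fin t → DualReal) :
    blockDiag (m + 1) (n + 1) (Fin.cons p μ : Fin (t + 1) → DualReal) =
      Matrix.borderDiag p.toDualQuat (blockDiag m n μ) := by
  apply Matrix.ext_fin_succ
  · simp [blockDiag]
  · intro j
    simp [blockDiag]
  · intro i
    simp [blockDiag]
  · intro i j
    simp only [blockDiag, Matrix.of_apply, Fin.val_succ, Nat.add_right_cancel_iff,
      Nat.add_lt_add_iff_right, Matrix.borderDiag_succ_succ]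
    rfl

/-- `B` sends the first column of `U` to `μ` times that of `V`, and `Vᴴ` sends the latter to `e₀`.
Applied to `Bᴴ` as well, this also clears the first row. -/
theorem conjTranspose_mul_mul_apply_zero {m n : ℕ}
    {B : Matrix (Fin (m + 1)) (Fin (n + 1)) DualQuat}
    {V : Matrix (Fin (m + 1)) (Fin (m + 1)) DualQuat} (hV : IsUnitary V)
    {U : Matrix (Fin (n + 1)) (Fin (n + 1)) DualQuat} {μ : DualReal}
    (h : (B *ᵥ fun i => U i 0) = μ.toDualQuat • fun i => V i 0) (i : Fin (m + 1)) :
    (Vᴴ * B * U) i 0 = μ.toDualQuat * (1 : Matrix (Fin (m + 1)) (Fin (m + 1)) DualQuat) i 0 := by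
  have hcol : ∀ k, (B * U) k 0 = μ.toDualQuat * V k 0 := fun k => congrFun h k
  rw [← hV, Matrix.mul_assoc, Matrix.mul_apply, Matrix.mul_apply, Finset.mul_sum]
  refine Finset.sum_congr rfl fun k _ => ?_
  rw [hcol, ← mul_assoc, ← μ.toDualQuat_commute, mul_assoc]

/-- The singular value decomposition without ordering of the singular values. -/
theorem exists_isUnitary_mul_mul_eq_blockDiag {m n : ℕ} (B : Matrix (Fin m) (Fin n) DualQuat) :
    ∃ (V : Matrix (Fin m) (Fin m) DualQuat) (U : Matrix (Fin n) (Fin n) DualQuat) (t : ℕ)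
      (μ : Fin t → DualReal), IsUnitary V ∧ IsUnitary U ∧ t ≤ min m n ∧ (∀ i, 0 < μ i) ∧
        Vᴴ * B * U = blockDiag m n μ := by
  have hzero : ∀ {m n : ℕ}, ∃ (V : Matrix (Fin m) (Fin m) DualQuat)
      (U : Matrix (Fin n) (Fin n) DualQuat) (t : ℕ) (μ : Fin t → DualReal),
      IsUnitary V ∧ IsUnitary U ∧ t ≤ min m n ∧ (∀ i, 0 < μ i) ∧
        Vᴴ * (0 : Matrix (Fin m) (Fin n) DualQuat) * U = blockDiag m n μ := by
    intro m n
    refine ⟨1, 1, 0, Fin.elim0, isUnitary_one, isUnitary_one, Nat.zero_le _, fun i => i.elim0, ?_⟩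
    ext1 i j
    rw [blockDiag_of_le_left _ _ (Nat.zero_le _)]
    simp
  induction m generalizing n with
  | zero => rw [Subsingleton.elim B 0]; exact hzero
  | succ m ih =>
    cases n with
    | zero => rw [Subsingleton.elim B 0]; exact hzero
    | succ n =>
      by_cases hB : B = 0
      · rw [hB]; exact hzero
      obtain ⟨u, v, p, hp, huv⟩ := exists_isSingularPair hB
      obtain ⟨V, hV, hVv⟩ := exists_isUnitary_col_zero v huv.unit_left
      obtain ⟨U, hU, hUu⟩ := exists_isUnitary_col_zero u huv.unit_right
      obtain rfl : (fun i => V i 0) = v := funext hVv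
      obtain rfl : (fun i => U i 0) = u := funext hUu
      have hleft := conjTranspose_mul_mul_apply_zero hV huv.mulVec_right
      have hright := conjTranspose_mul_mul_apply_zero hU huv.mulVec_left
      obtain ⟨V', U', t, μ, hV', hU', ht, hμ, h⟩ :=
        ih ((Vᴴ * B * U).submatrix Fin.succ Fin.succ)
      have hM : Vᴴ * B * U =
          Matrix.borderDiag p.toDualQuat ((Vᴴ * B * U).submatrix Fin.succ Fin.succ) := by
        apply Matrix.ext_fin_succ
        · simp [hleft]
        · intro j
          have hadj : Vᴴ * B * U = (Uᴴ * Bᴴ * V)ᴴ := by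
            simp [Matrix.mul_assoc]
          rw [hadj, Matrix.conjTranspose_apply, hright]
          simp
        · intro i
          simp [hleft]
        · intro i j
          rfl
      refine ⟨V * Matrix.borderDiag 1 V', U * Matrix.borderDiag 1 U', t + 1, Fin.cons p μ,
        hV.mul hV'.borderDiag, hU.mul hU'.borderDiag, by omega, Fin.cases hp hμ, ?_⟩
      calc (V * Matrix.borderDiag 1 V')ᴴ * B * (U * Matrix.borderDiag 1 U')
          = (Matrix.borderDiag 1 V')ᴴ * (Vᴴ * B * U) * Matrix.borderDiag 1 U' := by
            simp only [Matrix.conjTranspose_mul, Matrix.mul_assoc]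
        _ = _ := by
            rw [hM, Matrix.borderDiag_conjTranspose, Matrix.borderDiag_mul, Matrix.borderDiag_mul,
              h, blockDiag_cons, star_one, one_mul, mul_one]

/-- The permutation is extended by the identity to both index sets, so sorting the singular values
only permutes the columns of the unitary factors. -/
theorem blockDiag_submatrix_perm {m n t : ℕ} (μ : Fin t → DualReal) (hm : t ≤ m) (hn : t ≤ n)
    (σ : Equiv.Perm (Fin t)) :
    (blockDiag m n μ).submatrix (σ.viaFintypeEmbedding (Fin.castLEEmb hm))
      (σ.viaFintypeEmbedding (Fin.castLEEmb hn)) = blockDiag m n (μ ∘ σ) := by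
  have hlt : ∀ {l : ℕ} (hl : t ≤ l) (a : Fin t),
      σ.viaFintypeEmbedding (Fin.castLEEmb hl) (Fin.castLE hl a) = Fin.castLE hl (σ a) :=
    fun hl a => Equiv.Perm.viaFintypeEmbedding_apply_image σ (Fin.castLEEmb hl) a
  have hge : ∀ {l : ℕ} (hl : t ≤ l) (i : Fin l), t ≤ i →
      σ.viaFintypeEmbedding (Fin.castLEEmb hl) i = i := by
    intro l hl i hi
    apply Equiv.Perm.viaFintypeEmbedding_apply_notMem_range
    rintro ⟨a, rfl⟩
    exact hi.not_gt a.2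
  ext1 i j
  rw [Matrix.submatrix_apply]
  by_cases hi : t ≤ i
  · rw [hge hm i hi, blockDiag_of_le_left _ _ hi, blockDiag_of_le_left _ _ hi]
  by_cases hj : t ≤ j
  · rw [hge hn j hj, blockDiag_of_le_right _ _ hj, blockDiag_of_le_right _ _ hj]
  obtain ⟨a, rfl⟩ : ∃ a, Fin.castLE hm a = i := ⟨⟨i, not_le.mp hi⟩, rfl⟩
  obtain ⟨b, rfl⟩ : ∃ b, Fin.castLE hn b = j := ⟨⟨j, not_le.mp hj⟩, rfl⟩
  rw [hlt, hlt, blockDiag_castLE, blockDiag_castLE]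
  simp

theorem exists_isSVD {m n : ℕ} (B : Matrix (Fin m) (Fin n) DualQuat) :
    ∃ (V : Matrix (Fin m) (Fin m) DualQuat) (U : Matrix (Fin n) (Fin n) DualQuat) (r t : ℕ)
      (μ : Fin t → DualReal), IsSVD B V U r t μ := by
  obtain ⟨V, U, t, μ, hV, hU, ht, hμ, h⟩ := exists_isUnitary_mul_mul_eq_blockDiag B
  have hm : t ≤ m := ht.trans (min_le_left _ _)
  have hn : t ≤ n := ht.trans (min_le_right _ _)
  set σ := Tuple.sort (OrderDual.toDual ∘ μ)
  have hanti : Antitone (μ ∘ σ) := Tuple.monotone_sort (OrderDual.toDual ∘ μ)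
  have hfst_nonneg : ∀ i, 0 ≤ ((μ ∘ σ) i).fst := fun i => by
    rcases DualReal.lt_iff.mp (hμ (σ i)) with h' | ⟨h', -⟩
    · exact h'.le
    · exact h'.le
  have hfst : Antitone fun i => ((μ ∘ σ) i).fst := fun i j hij => by
    rcases DualReal.le_iff.mp (hanti hij) with h' | ⟨h', -⟩
    · exact h'.le
    · exact h'.le
  -- `r` is the number of positive standard parts; by monotonicity these fill an initial segment.
  have hr := fun i => Tuple.lt_card_gt_iff_apply_gt_of_antitone (j := i) (a := 0) hfst
  refine ⟨_, _, _, t, μ ∘ σ, hV.submatrix (σ.viaFintypeEmbedding (Fin.castLEEmb hm)),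
    hU.submatrix (σ.viaFintypeEmbedding (Fin.castLEEmb hn)), ?_, ht, ?_, fun i => hμ _,
    fun i hi => ((hr i).mp hi).ne', fun i hi => ?_, fun i j hij _ => hanti hij,
    fun i j _ hij => hanti hij⟩
  · exact (Finset.card_le_univ _).trans (Fintype.card_fin t).le
  · rw [Matrix.conjTranspose_submatrix, ← blockDiag_submatrix_perm μ hm hn, ← h]
    rfl
  · exact le_antisymm (not_lt.mp fun h' => hi.not_gt ((hr i).mpr h')) (hfst_nonneg i)

end DualQuat

/-! ### Uniqueness of the singular values. -/

/-- If a quaternion unitary matrix `Z` has nonzero entries only where `f i = g j`, then `f` and `g`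
satisfy any given predicate equally often. -/
theorem Quaternion.card_filter_eq_of_unitary {n : ℕ} {α : Type*} {Z : Matrix (Fin n) (Fin n) ℍ[ℝ]}
    (h₁ : Zᴴ * Z = 1) (h₂ : Z * Zᴴ = 1) {f g : Fin n → α} (h : ∀ i j, f i ≠ g j → Z i j = 0)
    (P : α → Prop) [DecidablePred P] :
    (Finset.univ.filter fun i => P (f i)).card = (Finset.univ.filter fun j => P (g j)).card := by
  have hcol : ∀ j, ∑ i, Quaternion.normSq (Z i j) = 1 := fun j => by
    have := congrFun (congrFun h₁ j) j
    simp only [Matrix.mul_apply, Matrix.conjTranspose_apply, Quaternion.star_mul_self,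
      Matrix.one_apply_eq, ← coe_finset_sum, ← Quaternion.coe_one, Quaternion.coe_inj] at this
    exact this
  have hrow : ∀ i, ∑ j, Quaternion.normSq (Z i j) = 1 := fun i => by
    have := congrFun (congrFun h₂ i) i
    simp only [Matrix.mul_apply, Matrix.conjTranspose_apply, Quaternion.self_mul_star,
      Matrix.one_apply_eq, ← coe_finset_sum, ← Quaternion.coe_one, Quaternion.coe_inj] at this
    exact this
  -- The total squared norm of the block where `P` holds for both indices is computed by rows and by
  -- columns.
  have hcast : ((Finset.univ.filter fun i => P (f i)).card : ℝ) =
      (Finset.univ.filter fun j => P (g j)).card := by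
    simp only [Finset.cast_card]
    calc ∑ i with P (f i), (1 : ℝ)
        = ∑ i with P (f i), ∑ j with P (g j), Quaternion.normSq (Z i j) := by
          refine Finset.sum_congr rfl fun i hi => ?_
          rw [← hrow i, Finset.sum_filter_of_ne]
          intro j _ hne
          by_contra hj
          refine hne ?_
          rw [h i j fun heq => hj (heq ▸ (Finset.mem_filter.mp hi).2), map_zero]
      _ = ∑ j with P (g j), ∑ i with P (f i), Quaternion.normSq (Z i j) := Finset.sum_comm
      _ = ∑ j with P (g j), (1 : ℝ) := by
          refine Finset.sum_congr rfl fun j hj => ?_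
          rw [← hcol j, Finset.sum_filter_of_ne]
          intro i _ hne
          by_contra hi
          refine hne ?_
          rw [h i j fun heq => hi (heq ▸ (Finset.mem_filter.mp hj).2), map_zero]
  exact_mod_cast hcast

namespace DualReal

theorem eq_zero_of_add_eq_zero {p q : DualReal} (hp : 0 ≤ p) (hq : 0 ≤ q) (h : p + q = 0) :
    p = 0 ∧ q = 0 := by
  have h₁ := congrArg TrivSqZeroExt.fst h
  have h₂ := congrArg TrivSqZeroExt.snd h
  rw [TrivSqZeroExt.fst_add, TrivSqZeroExt.fst_zero] at h₁
  rw [TrivSqZeroExt.snd_add, TrivSqZeroExt.snd_zero] at h₂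
  rw [le_iff, TrivSqZeroExt.fst_zero, TrivSqZeroExt.snd_zero] at hp hq
  constructor <;> apply TrivSqZeroExt.ext <;>
    simp only [TrivSqZeroExt.fst_zero, TrivSqZeroExt.snd_zero] <;>
    rcases hp with hp | ⟨hp, hp'⟩ <;> rcases hq with hq | ⟨hq, hq'⟩ <;> linarith

/-- The hypotheses give `(p - q)(z + w) = 0` and `(p + q)(z - w) = 0` with nonzero dual factors, so
`z + w` and `z - w` are infinitesimal. Nonnegativity excludes `p + q = 0`. -/
theorem fst_eq_zero_of_mul_eq_mul {p q : DualReal} (hp : 0 ≤ p) (hq : 0 ≤ q) (hpq : p ≠ q)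
    {z w : DualQuat} (h₁ : p.toDualQuat * z = q.toDualQuat * w)
    (h₂ : p.toDualQuat * w = q.toDualQuat * z) : z.fst = 0 := by
  have hsum : (z + w).fst = 0 := by
    apply fst_eq_zero_of_toDualQuat_mul_eq_zero (sub_ne_zero.mpr hpq)
    rw [toDualQuat_sub, sub_mul, mul_add, mul_add, h₁, h₂]
    abel
  have hdiff : (z - w).fst = 0 := by
    apply fst_eq_zero_of_toDualQuat_mul_eq_zero (p := p + q)
    · intro h
      obtain ⟨rfl, rfl⟩ := eq_zero_of_add_eq_zero hp hq h
      exact hpq rfl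
    · rw [toDualQuat_add, add_mul, mul_sub, mul_sub, h₁, h₂]
      abel
  rw [TrivSqZeroExt.fst_add] at hsum
  rw [TrivSqZeroExt.fst_sub, sub_eq_zero] at hdiff
  rw [← hdiff] at hsum
  rw [← two_smul ℝ, smul_eq_zero] at hsum
  exact hsum.resolve_left two_ne_zero

/-- Extension of a finite sequence by zeros. -/
noncomputable def extendZero {t : ℕ} (μ : Fin t → DualReal) (k : ℕ) : DualReal :=
  if h : k < t then μ ⟨k, h⟩ else 0

theorem extendZero_of_lt {t : ℕ} (μ : Fin t → DualReal) {k : ℕ} (h : k < t) :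
    extendZero μ k = μ ⟨k, h⟩ := dif_pos h

theorem extendZero_of_le {t : ℕ} (μ : Fin t → DualReal) {k : ℕ} (h : t ≤ k) :
    extendZero μ k = 0 := dif_neg h.not_gt

end DualReal

namespace DualQuat

open DualReal

theorem blockDiag_apply {m n t : ℕ} (μ : Fin t → DualReal) (i : Fin m) (j : Fin n) :
    blockDiag m n μ i j = if i.val = j.val then (extendZero μ i).toDualQuat else 0 := by
  by_cases hi : i.val < t
  · by_cases hij : i.val = j.val
    · rw [if_pos hij, extendZero_of_lt μ hi]
      exact dif_pos ⟨hij, hi⟩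
    · rw [if_neg hij]
      exact dif_neg fun h' : i.val = j.val ∧ i.val < t => hij h'.1
  · rw [blockDiag_of_le_left μ j (not_lt.mp hi), extendZero_of_le μ (not_lt.mp hi),
      toDualQuat_zero, ite_self]

theorem blockDiag_conjTranspose {m n t : ℕ} (μ : Fin t → DualReal) :
    (blockDiag m n μ)ᴴ = blockDiag n m μ := by
  ext1 i j
  rw [Matrix.conjTranspose_apply, blockDiag_apply, blockDiag_apply]
  by_cases h : i.val = j.val
  · simp [h]
  · simp [h, Ne.symm h]

theorem blockDiag_mul_apply {l m n t : ℕ} (μ : Fin t → DualReal) (X : Matrix (Fin n) (Fin l) DualQuat)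
    (i : Fin m) (j : Fin l) (hi : i.val < n) :
    (blockDiag m n μ * X) i j = (extendZero μ i).toDualQuat * X ⟨i, hi⟩ j := by
  rw [Matrix.mul_apply, Finset.sum_eq_single ⟨i, hi⟩]
  · simp [blockDiag_apply]
  · intro k _ hk
    rw [blockDiag_apply, if_neg fun h => hk (Fin.ext h.symm), zero_mul]
  · simp

theorem mul_blockDiag_apply {l m n t : ℕ} (μ : Fin t → DualReal) (X : Matrix (Fin l) (Fin m) DualQuat)
    (i : Fin l) (j : Fin n) (hj : j.val < m) :
    (X * blockDiag m n μ) i j = (extendZero μ j).toDualQuat * X i ⟨j, hj⟩ := by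
  rw [Matrix.mul_apply, Finset.sum_eq_single ⟨j, hj⟩]
  · simp [blockDiag_apply, toDualQuat_commute]
  · intro k _ hk
    rw [blockDiag_apply, if_neg fun h => hk (Fin.ext h), mul_zero]
  · simp

theorem blockDiag_mul_apply_of_le {l m n t : ℕ} (μ : Fin t → DualReal)
    (X : Matrix (Fin n) (Fin l) DualQuat) (i : Fin m) (j : Fin l) (hi : t ≤ i) :
    (blockDiag m n μ * X) i j = 0 := by
  rw [Matrix.mul_apply]
  exact Finset.sum_eq_zero fun k _ => by rw [blockDiag_of_le_left _ _ hi, zero_mul]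

theorem mul_blockDiag_apply_of_le {l m n t : ℕ} (μ : Fin t → DualReal)
    (X : Matrix (Fin l) (Fin m) DualQuat) (i : Fin l) (j : Fin n) (hj : t ≤ j) :
    (X * blockDiag m n μ) i j = 0 := by
  rw [Matrix.mul_apply]
  exact Finset.sum_eq_zero fun k _ => by rw [blockDiag_of_le_right _ _ hj, mul_zero]

namespace IsSVD

variable {m n r r' t t' : ℕ} {B : Matrix (Fin m) (Fin n) DualQuat}
  {V V' : Matrix (Fin m) (Fin m) DualQuat} {U U' : Matrix (Fin n) (Fin n) DualQuat}
  {μ : Fin t → DualReal} {μ' : Fin t' → DualReal}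

theorem antitone (h : IsSVD B V U r t μ) : Antitone μ := by
  intro i j hij
  by_cases hj : j.val < r
  · exact h.appreciable_antitone i j hij hj
  by_cases hi : r ≤ i.val
  · exact h.infinitesimal_antitone i j hi hij
  have happ := h.appreciable i (not_le.mp hi)
  have hinf := h.infinitesimal j (not_lt.mp hj)
  refine Or.inl ?_
  rw [show TrivSqZeroExt.fst (μ j) = 0 from hinf]
  rcases lt_iff.mp (h.pos i) with h' | ⟨h', -⟩
  · exact h'
  · exact absurd h'.symm happ

theorem extendZero_nonneg (h : IsSVD B V U r t μ) (k : ℕ) : 0 ≤ extendZero μ k := by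
  unfold extendZero
  split_ifs
  · exact (h.pos _).le
  · exact le_rfl

theorem antitone_extendZero (h : IsSVD B V U r t μ) : Antitone (extendZero μ) := by
  intro i j hij
  by_cases hj : j < t
  · rw [extendZero_of_lt μ hj, extendZero_of_lt μ (hij.trans_lt hj)]
    exact h.antitone hij
  · rw [extendZero_of_le μ (not_lt.mp hj)]
    exact h.extendZero_nonneg i

/-- Both sides equal `Vᴴ * B * U'`. -/
theorem blockDiag_mul_eq (h : IsSVD B V U r t μ) (h' : IsSVD B V' U' r' t' μ') :
    blockDiag m n μ * (Uᴴ * U') = (Vᴴ * V') * blockDiag m n μ' := by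
  rw [← h.eq_blockDiag, ← h'.eq_blockDiag]
  calc Vᴴ * B * U * (Uᴴ * U') = Vᴴ * B * (U * Uᴴ) * U' := by simp only [Matrix.mul_assoc]
    _ = Vᴴ * (V' * V'ᴴ) * B * U' := by
      rw [h.unitary_right.mul_conjTranspose, h'.unitary_left.mul_conjTranspose, Matrix.mul_one,
        Matrix.mul_one]
    _ = Vᴴ * V' * (V'ᴴ * B * U') := by simp only [Matrix.mul_assoc]

theorem conjTranspose (h : IsSVD B V U r t μ) : IsSVD Bᴴ U V r t μ :=
  { h with
    unitary_left := h.unitary_right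
    unitary_right := h.unitary_left
    t_le_min := min_comm m n ▸ h.t_le_min
    eq_blockDiag := by
      rw [← blockDiag_conjTranspose, ← h.eq_blockDiag]
      simp [Matrix.mul_assoc] }

/-- The unitary matrix relating two decompositions has an infinitesimal entry wherever the
corresponding singular values differ. -/
theorem fst_conjTranspose_mul_apply (h : IsSVD B V U r t μ) (h' : IsSVD B V' U' r' t' μ')
    {i j : Fin n} (hij : extendZero μ i ≠ extendZero μ' j) : ((Uᴴ * U') i j).fst = 0 := by
  have hD := h.blockDiag_mul_eq h'
  have hDc := h.conjTranspose.blockDiag_mul_eq h'.conjTranspose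
  have ht : t ≤ m := h.t_le_min.trans (min_le_left _ _)
  have ht' : t' ≤ m := h'.t_le_min.trans (min_le_left _ _)
  -- `w` is the matching entry of `Vᴴ * V'` when both indices are below `m`. If exactly one is, its
  -- partner value is a padding zero and `w = 0` works.
  suffices ∃ w : DualQuat,
      (extendZero μ i).toDualQuat * (Uᴴ * U') i j = (extendZero μ' j).toDualQuat * w ∧
      (extendZero μ i).toDualQuat * w = (extendZero μ' j).toDualQuat * (Uᴴ * U') i j by
    obtain ⟨w, hw₁, hw₂⟩ := this
    exact fst_eq_zero_of_mul_eq_mul (h.extendZero_nonneg _) (h'.extendZero_nonneg _) hij hw₁ hw₂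
  by_cases hi : i.val < m <;> by_cases hj : j.val < m
  · refine ⟨(Vᴴ * V') ⟨i, hi⟩ ⟨j, hj⟩, ?_, ?_⟩
    · have := congrFun (congrFun hD ⟨i, hi⟩) j
      rwa [blockDiag_mul_apply _ _ ⟨i, hi⟩ _ i.2, mul_blockDiag_apply _ _ _ _ hj] at this
    · have := congrFun (congrFun hDc i) ⟨j, hj⟩
      rwa [blockDiag_mul_apply _ _ _ _ hi, mul_blockDiag_apply _ _ _ ⟨j, hj⟩ j.2] at this
  · have hj' : t' ≤ j := ht'.trans (not_lt.mp hj)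
    refine ⟨0, ?_, ?_⟩
    · have := congrFun (congrFun hD ⟨i, hi⟩) j
      rw [blockDiag_mul_apply _ _ ⟨i, hi⟩ _ i.2, mul_blockDiag_apply_of_le _ _ _ _ hj'] at this
      rw [mul_zero]
      exact this
    · rw [extendZero_of_le μ' hj']
      simp
  · have hi' : t ≤ i := ht.trans (not_lt.mp hi)
    refine ⟨0, ?_, ?_⟩
    · rw [extendZero_of_le μ hi']
      simp
    · have := congrFun (congrFun hDc i) ⟨j, hj⟩
      rw [blockDiag_mul_apply_of_le _ _ _ _ hi', mul_blockDiag_apply _ _ _ ⟨j, hj⟩ j.2] at this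
      rw [mul_zero]
      exact this
  · rw [extendZero_of_le μ (ht.trans (not_lt.mp hi)),
      extendZero_of_le μ' (ht'.trans (not_lt.mp hj))] at hij
    exact absurd rfl hij

theorem extendZero_eq (h : IsSVD B V U r t μ) (h' : IsSVD B V' U' r' t' μ') {k : ℕ} (hk : k < n) :
    extendZero μ k = extendZero μ' k := by
  have hZ : IsUnitary (Uᴴ * U') := h.unitary_right.conjTranspose.mul h'.unitary_right
  have hone : (1 : Matrix (Fin n) (Fin n) DualQuat).map TrivSqZeroExt.fst = 1 :=
    Matrix.map_one _ TrivSqZeroExt.fst_zero TrivSqZeroExt.fst_one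
  have hcard := fun a : DualReal => Quaternion.card_filter_eq_of_unitary
    (Z := (Uᴴ * U').map TrivSqZeroExt.fst) (f := fun i : Fin n => extendZero μ i)
    (g := fun i : Fin n => extendZero μ' i)
    (by rw [← map_fst_conjTranspose, ← map_fst_mul, hZ, hone])
    (by rw [← map_fst_conjTranspose, ← map_fst_mul, hZ.mul_conjTranspose, hone])
    (fun i j hij => h.fst_conjTranspose_mul_apply h' hij) (fun p => a < p)
  have hμ : Antitone fun i : Fin n => extendZero μ i := fun i j hij => h.antitone_extendZero hij
  have hμ' : Antitone fun i : Fin n => extendZero μ' i := fun i j hij => h'.antitone_extendZero hij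
  -- An antitone sequence is determined by how many of its terms exceed each `a`.
  refine eq_of_forall_lt_iff fun a => ?_
  have h₁ := Tuple.lt_card_gt_iff_apply_gt_of_antitone (j := (⟨k, hk⟩ : Fin n)) (a := a) hμ
  have h₂ := Tuple.lt_card_gt_iff_apply_gt_of_antitone (j := (⟨k, hk⟩ : Fin n)) (a := a) hμ'
  rw [← h₁, ← h₂, hcard a]

theorem card_le (h : IsSVD B V U r t μ) (h' : IsSVD B V' U' r' t' μ') : t' ≤ t := by
  by_contra! hlt
  -- At index `t` the first sequence is padded by zero while the second is still positive.
  have := h.extendZero_eq h' (hlt.trans_le (h'.t_le_min.trans (min_le_right _ _)))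
  rw [extendZero_of_le μ le_rfl, extendZero_of_lt μ' hlt] at this
  exact (h'.pos _).ne this

theorem card_appreciable_le {μ' : Fin t → DualReal} (h : IsSVD B V U r t μ)
    (h' : IsSVD B V' U' r' t μ') (hμ : μ = μ') : r' ≤ r := by
  subst hμ
  by_contra! hlt
  have hrt : r < t := hlt.trans_le h'.r_le_t
  exact h'.appreciable ⟨r, hrt⟩ hlt (h.infinitesimal ⟨r, hrt⟩ le_rfl)

end IsSVD

end DualQuat

theorem theorem6p1 (m n : ℕ) (B : Matrix (Fin m) (Fin n) DualQuat) :
    (∃ (V : Matrix (Fin m) (Fin m) DualQuat) (U : Matrix (Fin n) (Fin n) DualQuat)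
      (r t : ℕ) (μ : Fin t → DualReal), DualQuat.IsSVD B V U r t μ) ∧
    (∀ (V V' : Matrix (Fin m) (Fin m) DualQuat) (U U' : Matrix (Fin n) (Fin n) DualQuat)
      (r r' t t' : ℕ) (μ : Fin t → DualReal) (μ' : Fin t' → DualReal),
      DualQuat.IsSVD B V U r t μ → DualQuat.IsSVD B V' U' r' t' μ' →
        r = r' ∧ ∃ h : t = t', ∀ i : Fin t, μ i = μ' (Fin.cast h i)) := by
  refine ⟨DualQuat.exists_isSVD B, fun V V' U U' r r' t t' μ μ' h h' => ?_⟩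
  obtain rfl : t = t' := le_antisymm (h'.card_le h) (h.card_le h')
  have hμ : μ = μ' := funext fun i => by
    have := h.extendZero_eq h' (i.2.trans_le (h.t_le_min.trans (min_le_right _ _)))
    rwa [DualReal.extendZero_of_lt μ i.2, DualReal.extendZero_of_lt μ' i.2] at this
  exact ⟨le_antisymm (h'.card_appreciable_le h hμ.symm) (h.card_appreciable_le h' hμ), rfl,
    fun i => congrFun hμ i⟩
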